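/- Let $(W,S)$ be a finite Coxeter system, with geometric representation $V$ and set of reflections $T=\bigcup_{w\in W} wSw^{-1}$. For $w\in W$ let $V^w=\{x\in V : w(x)=x\}$; let $\ell_T(w)$ be the smallest $k$ such that $w$ is a product of $k$ elements of $T$; write $v\leq_T u$ if $\ell_T(v)+\ell_T(v^{-1}u)=\ell_T(u)$ (the absolute order); and let $P(w)$ be the parabolic closure of $w$, that is, the smallest subgroup containing $w$ of the form $x\langle I\rangle x^{-1}$ with $x\in W$ and $I\subseteq S$ (equivalently, the intersection of all such subgroups containing $w$). Let $u\in W$ be an involution, i.e. $u^2=1$ (the case $u=1$ is allowed), and let $v\in W$. Then the following are equivalent: 1. $v\leq_T u$; 2. $v^2=1$ and $v\in P(u)$; 3. $v^2=1$ and $V^u\subseteq V^v$. If any of these conditions holds, then $uv=vu$. -/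

import Mathlib

namespace CoxeterMatrix

variable {B : Type*} (M : CoxeterMatrix B)

/-- The canonical symmetric bilinear form on the real vector space with basis the simple roots
`α_i = Finsupp.single i 1`, given by `⟨α_i, α_j⟩ = - cos (π / m_{ij})`. In Mathlib the label `∞` is
encoded as `0`, and then the value is `- cos 0 = -1`, as it should be. -/
noncomputable def cosForm : LinearMap.BilinForm ℝ (B →₀ ℝ) :=
  Finsupp.linearCombination ℝ fun i =>
    Finsupp.linearCombination ℝ fun j => -Real.cos (Real.pi / (M i j : ℝ))

theorem cosForm_single (i j : B) :
    M.cosForm (Finsupp.single i 1) (Finsupp.single j 1) = -Real.cos (Real.pi / (M i j : ℝ)) := by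
  simp [cosForm]

theorem two_cosForm_self (i : B) :
    ((2 : ℝ) • M.cosForm (Finsupp.single i 1)) (Finsupp.single i 1) = 2 := by
  simp [cosForm_single]

/-- The reflection `σ_i : x ↦ x - 2 ⟨α_i, x⟩ α_i` of the geometric representation. -/
noncomputable def geomReflection (i : B) : (B →₀ ℝ) ≃ₗ[ℝ] (B →₀ ℝ) :=
  Module.reflection (M.two_cosForm_self i)

theorem geomReflection_apply (i : B) (x : B →₀ ℝ) :
    M.geomReflection i x = x - (2 * M.cosForm (Finsupp.single i 1) x) • Finsupp.single i 1 := by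
  simp [geomReflection, Module.reflection_apply]

/-- The reflections `σ_i` satisfy the defining relations of the Coxeter group. -/
theorem isLiftable_geomReflection : M.IsLiftable M.geomReflection := by
  intro i j
  rcases eq_or_ne i j with rfl | hij
  · rw [M.diagonal, pow_one]
    ext1 x
    exact Module.involutive_reflection (M.two_cosForm_self i) x
  obtain hm | hm | hm : M i j = 0 ∨ M i j = 2 ∨ 3 ≤ M i j := by
    have := M.off_diagonal i j hij
    omega
  · rw [hm, pow_zero]
  · have h1 : M.cosForm (Finsupp.single i 1) (Finsupp.single j 1) = 0 := by
      simp [cosForm_single, hm]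
    have h2 : M.cosForm (Finsupp.single j 1) (Finsupp.single i 1) = 0 := by
      simp [cosForm_single, M.symmetric j i, hm]
    have h3 : M.cosForm (Finsupp.single i 1) (Finsupp.single i 1) = 1 := by simp [cosForm_single]
    have h4 : M.cosForm (Finsupp.single j 1) (Finsupp.single j 1) = 1 := by simp [cosForm_single]
    ext1 x
    rw [hm, pow_two]
    simp only [LinearEquiv.mul_apply, geomReflection_apply, map_sub, map_smul, smul_eq_mul,
      h1, h2, h3, h4, LinearEquiv.coe_one, id]
    module
  · set m := M i j with hmdef
    set θ : ℝ := 2 * Real.pi / m with hθ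
    have hm0 : (0 : ℝ) < m := by
      have : 0 < m := by omega
      exact_mod_cast this
    have hm3 : (3 : ℝ) ≤ m := by exact_mod_cast hm
    have hmθ : (m : ℝ) * θ = 2 * Real.pi := by rw [hθ]; field_simp
    have hsin : Real.sin θ ≠ 0 := by
      refine (Real.sin_pos_of_pos_of_lt_pi ?_ ?_).ne'
      · rw [hθ]; positivity
      · nlinarith [Real.pi_pos]
    have hU (n : ℤ) : (Polynomial.Chebyshev.S ℝ n).eval (2 * Real.cos θ) * Real.sin θ
        = Real.sin ((n + 1) * θ) := by
      rw [← Polynomial.Chebyshev.U_real_cos θ n, ← Polynomial.Chebyshev.S_comp_two_mul_X]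
      simp
    have ht : 2 * Real.cos θ =
        ((2 : ℝ) • M.cosForm (Finsupp.single i 1)) (Finsupp.single j 1) *
          ((2 : ℝ) • M.cosForm (Finsupp.single j 1)) (Finsupp.single i 1) - 2 := by
      have : θ = 2 * (Real.pi / m) := by rw [hθ]; ring
      rw [this, Real.cos_two_mul]
      simp only [LinearMap.smul_apply, cosForm_single, M.symmetric j i, smul_eq_mul, ← hmdef]
      ring
    ext1 x
    have key := Module.reflection_mul_reflection_pow_apply (M.two_cosForm_self i)
      (M.two_cosForm_self j) m x (2 * Real.cos θ) ht
    refine key.trans ?_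
    rcases Nat.even_or_odd' m with ⟨k, hk | hk⟩
    · have e1 : ((m : ℤ) - 2) / 2 = k - 1 := by omega
      have e2 : ((m : ℤ) - 1) / 2 = k - 1 := by omega
      have h0 : (Polynomial.Chebyshev.S ℝ ((k : ℤ) - 1)).eval (2 * Real.cos θ) = 0 := by
        have h := hU ((k : ℤ) - 1)
        have hk' : (k : ℝ) * θ = Real.pi := by
          have : (m : ℝ) = 2 * k := by exact_mod_cast hk
          rw [this] at hmθ
          linarith
        push_cast at h
        rw [sub_add_cancel, hk', Real.sin_pi] at h
        exact (mul_eq_zero.mp h).resolve_right hsin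
      rw [e1, e2, h0]
      simp
    · have e1 : ((m : ℤ) - 2) / 2 = k - 1 := by omega
      have e2 : ((m : ℤ) - 1) / 2 = k := by omega
      have e3 : ((m : ℤ) - 3) / 2 = k - 1 := by omega
      have e4 : (m : ℤ) / 2 = k := by omega
      have h0 : (Polynomial.Chebyshev.S ℝ (k : ℤ)).eval (2 * Real.cos θ) +
          (Polynomial.Chebyshev.S ℝ ((k : ℤ) - 1)).eval (2 * Real.cos θ) = 0 := by
        have h := hU ((k : ℤ) - 1)
        have h' := hU (k : ℤ)
        have hk' : ((k : ℝ) + 1) * θ = 2 * Real.pi - k * θ := by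
          have : (m : ℝ) = 2 * k + 1 := by exact_mod_cast hk
          rw [this] at hmθ
          linarith
        push_cast at h h'
        rw [sub_add_cancel] at h
        rw [hk', Real.sin_two_pi_sub] at h'
        refine (mul_eq_zero.mp ?_).resolve_right hsin
        rw [add_mul, h, h']
        ring
      rw [e1, e2, e3, e4, h0]
      simp

end CoxeterMatrix

namespace CoxeterSystem

variable {B W : Type*} [Group W] {M : CoxeterMatrix B} (cs : CoxeterSystem M W)

/-- The geometric representation of a Coxeter system, on the real vector space `V` with basis
the simple roots; the simple reflection `s_i` acts as `σ_i`. -/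
noncomputable def geomRep : W →* ((B →₀ ℝ) ≃ₗ[ℝ] (B →₀ ℝ)) :=
  cs.lift ⟨M.geomReflection, M.isLiftable_geomReflection⟩

theorem geomRep_simple (i : B) : cs.geomRep (cs.simple i) = M.geomReflection i :=
  cs.lift_apply_simple M.isLiftable_geomReflection i

/-- The fixed space `V^w` of `w` in the geometric representation. -/
def fixedSpace (w : W) : Submodule ℝ (B →₀ ℝ) where
  carrier := {x | cs.geomRep w x = x}
  add_mem' {x y} hx hy := by
    change cs.geomRep w (x + y) = x + y
    rw [map_add, hx, hy]
  zero_mem' := map_zero (cs.geomRep w)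
  smul_mem' c x hx := by
    change cs.geomRep w (c • x) = c • x
    rw [map_smul, hx]

/-- The reflection length `ℓ_T(w)`: the least `k` such that `w` is a product of `k` reflections. -/
noncomputable def reflectionLength (w : W) : ℕ :=
  sInf {k | ∃ l : List W, (∀ t ∈ l, cs.IsReflection t) ∧ l.prod = w ∧ l.length = k}

/-- The minimum in the definition of the reflection length is attained. -/
theorem exists_list_length_eq_reflectionLength (w : W) :
    ∃ l : List W, (∀ t ∈ l, cs.IsReflection t) ∧ l.prod = w ∧
      l.length = cs.reflectionLength w := by
  refine Nat.sInf_mem (s := {k | ∃ l : List W, (∀ t ∈ l, cs.IsReflection t) ∧ l.prod = w ∧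
    l.length = k}) ?_
  obtain ⟨ω, rfl⟩ := cs.wordProd_surjective w
  refine ⟨_, ω.map cs.simple, ?_, rfl, rfl⟩
  intro t ht
  obtain ⟨i, -, rfl⟩ := List.mem_map.mp ht
  exact cs.isReflection_simple i

/-- The absolute order `v ≤_T u` on `W`. -/
def AbsLE (v u : W) : Prop :=
  cs.reflectionLength v + cs.reflectionLength (v⁻¹ * u) = cs.reflectionLength u

/-- The standard parabolic subgroup `W_I` generated by the simple reflections in `I`. -/
def standardParabolic (I : Set B) : Subgroup W :=
  Subgroup.closure (cs.simple '' I)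

/-- Parabolic subgroups: the conjugates `w W_I w⁻¹` of the standard parabolic subgroups. -/
def IsParabolic (P : Subgroup W) : Prop :=
  ∃ (w : W) (I : Set B), P = (cs.standardParabolic I).map (MulAut.conj w).toMonoidHom

/-- The parabolic closure `P(w)`: the intersection of all parabolic subgroups containing `w`. -/
def parabolicClosure (w : W) : Subgroup W :=
  sInf {P | cs.IsParabolic P ∧ w ∈ P}

/-- If there is a smallest parabolic subgroup containing `w`, it is the parabolic closure. -/
theorem parabolicClosure_eq_of_isLeast {w : W} {P : Subgroup W}
    (h : IsLeast {P | cs.IsParabolic P ∧ w ∈ P} P) : cs.parabolicClosure w = P :=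
  h.csInf_eq

end CoxeterSystem

/-! Everything is read off fixed spaces. Parabolic subgroups are exactly the stabilizers of vectors,
so P(u) is the pointwise stabilizer of V^u (`mem_parabolicClosure_iff`); this is 2 ⇔ 3. Carter's
lemma (`reflectionLength_add_finrank_fixedSpace`), ℓ_T(w) = codim V^w, turns v ≤_T u into an
equality of dimensions, which forces V^v ∩ V^{v⁻¹u} = V^u and V^v + V^{v⁻¹u} = V.

The rest is linear algebra. If u² = 1 and V^u ⊆ V^v, then u, hence v, fixes x + ux, so vu = 1 + u -
v on V. This identity gives v² = 1 in 1 ⇒ 3, and commutation and the dimension count in 3 ⇒ 1.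

Both inputs rest on the sign of the root wα_i, governed by whether s_i lengthens or shortens w, and
on an inner product obtained by summing over the finite group W. -/

namespace CoxeterMatrix

/-! ### Rank two coefficients. -/

variable {B : Type*} (M : CoxeterMatrix B)

/-- The coefficients of the roots in a rank two root system with Gram entry `-cos (π / m)`
satisfy a Chebyshev recursion, and are nonnegative up to the index `m`. -/
theorem exists_nonneg_chebyshev_seq {m : ℕ} (hm : m ≠ 1) :
    ∃ a : ℕ → ℝ, a 0 = 0 ∧ a 1 = 1 ∧
      (∀ p, a (p + 2) = 2 * Real.cos (Real.pi / m) * a (p + 1) - a p) ∧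
      ∀ p, (m ≠ 0 → p ≤ m) → 0 ≤ a p := by
  rcases Nat.eq_zero_or_pos m with rfl | hpos
  -- The label `0` encodes ∞: `π / 0 = 0`, the cosine is 1 and the recursion is arithmetic.
  · refine ⟨fun p => p, by simp, by simp, fun p => ?_, fun p _ => by positivity⟩
    push_cast
    simp
    ring
  · have hm2 : (2 : ℝ) ≤ m := by
      have : 2 ≤ m := by omega
      exact_mod_cast this
    have hm0 : (0 : ℝ) < m := by linarith
    set θ : ℝ := Real.pi / m with hθ
    have hmθ : (m : ℝ) * θ = Real.pi := by rw [hθ]; field_simp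
    have hθ0 : 0 < θ := by rw [hθ]; exact div_pos Real.pi_pos hm0
    have hsin : 0 < Real.sin θ :=
      Real.sin_pos_of_pos_of_lt_pi hθ0 (by nlinarith [Real.pi_pos])
    refine ⟨fun p => Real.sin (p * θ) / Real.sin θ, by simp, ?_, fun p => ?_, fun p hp => ?_⟩
    · simp [hsin.ne']
    · have h : Real.sin ((p + 2 : ℕ) * θ) + Real.sin (p * θ) =
          2 * Real.cos θ * Real.sin ((p + 1 : ℕ) * θ) := by
        have e1 : ((p + 2 : ℕ) : ℝ) * θ = (p + 1 : ℕ) * θ + θ := by push_cast; ring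
        have e2 : (p : ℝ) * θ = (p + 1 : ℕ) * θ - θ := by push_cast; ring
        rw [e1, e2, Real.sin_add, Real.sin_sub]
        ring
      rw [← mul_div_assoc, ← h]
      ring
    · refine div_nonneg (Real.sin_nonneg_of_nonneg_of_le_pi (by positivity) ?_) hsin.le
      rw [← hmθ]
      have : (p : ℝ) ≤ m := by exact_mod_cast hp hpos.ne'
      gcongr

theorem geomReflection_single_self (i : B) :
    M.geomReflection i (Finsupp.single i 1) = -Finsupp.single i 1 := by
  rw [geomReflection_apply, cosForm_single, M.diagonal, Nat.cast_one, div_one, Real.cos_pi]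
  module

theorem geomReflection_single (i j : B) :
    M.geomReflection i (Finsupp.single j 1) =
      Finsupp.single j 1 + (2 * Real.cos (Real.pi / M i j)) • Finsupp.single i 1 := by
  rw [geomReflection_apply, cosForm_single]
  module

end CoxeterMatrix

/-! ### Signs of roots and faithfulness. -/

namespace CoxeterSystem

variable {B W : Type*} [Group W] {M : CoxeterMatrix B} (cs : CoxeterSystem M W)

/-- The root `w α_i`. -/
noncomputable def root (w : W) (i : B) : B →₀ ℝ := cs.geomRep w (Finsupp.single i 1)

theorem geomRep_mul_apply (v w : W) (x : B →₀ ℝ) :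
    cs.geomRep (v * w) x = cs.geomRep v (cs.geomRep w x) := by
  rw [map_mul, LinearEquiv.mul_apply]

theorem geomRep_one_apply (x : B →₀ ℝ) : cs.geomRep 1 x = x := by
  rw [map_one, LinearEquiv.coe_one, id]

theorem geomRep_inv_apply_self (w : W) (x : B →₀ ℝ) :
    cs.geomRep w⁻¹ (cs.geomRep w x) = x := by
  rw [← geomRep_mul_apply, inv_mul_cancel, geomRep_one_apply]

theorem geomRep_apply_inv_self (w : W) (x : B →₀ ℝ) :
    cs.geomRep w (cs.geomRep w⁻¹ x) = x := by
  rw [← geomRep_mul_apply, mul_inv_cancel, geomRep_one_apply]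

theorem root_mul_simple_self (w : W) (i : B) : cs.root (w * cs.simple i) i = -cs.root w i := by
  rw [root, root, geomRep_mul_apply, geomRep_simple, M.geomReflection_single_self, map_neg]

theorem root_mul_simple (w : W) (i j : B) :
    cs.root (w * cs.simple i) j =
      cs.root w j + (2 * Real.cos (Real.pi / M i j)) • cs.root w i := by
  rw [root, root, root, geomRep_mul_apply, geomRep_simple, M.geomReflection_single, map_add,
    map_smul]

theorem wordProd_alternatingWord_succ (i j : B) (p : ℕ) :
    cs.wordProd (alternatingWord i j (p + 1)) =
      cs.simple (if Even p then j else i) * cs.wordProd (alternatingWord i j p) := by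
  rw [alternatingWord_succ', wordProd_cons]

/-- Stripping an alternating word from the right expresses `w α_i` through two roots of the
remaining element. -/
theorem root_eq_add_of_chebyshev {a : ℕ → ℝ} {i j : B} (h0 : a 0 = 0) (h1 : a 1 = 1)
    (ha : ∀ p, a (p + 2) = 2 * Real.cos (Real.pi / M i j) * a (p + 1) - a p) (w : W) (p : ℕ) :
    cs.root w i =
      a p • cs.root (w * (cs.wordProd (alternatingWord i j p))⁻¹) (if Even p then j else i) +
      a (p + 1) •
        cs.root (w * (cs.wordProd (alternatingWord i j p))⁻¹) (if Even p then i else j) := by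
  induction p with
  | zero => simp [alternatingWord, h0, h1]
  | succ p ih =>
    set v := w * (cs.wordProd (alternatingWord i j (p + 1)))⁻¹ with hv
    have hv' : w * (cs.wordProd (alternatingWord i j p))⁻¹ =
        v * cs.simple (if Even p then j else i) := by
      rw [hv, wordProd_alternatingWord_succ]
      simp [mul_assoc]
    rw [ih, hv', ha]
    by_cases hp : Even p
    · simp only [hp, Nat.even_add_one, if_true, not_true, if_false, root_mul_simple_self,
        root_mul_simple, M.symmetric j i]
      module
    · simp only [hp, Nat.even_add_one, not_false_iff, if_true, if_false, root_mul_simple_self,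
        root_mul_simple]
      module

theorem length_mul_inv_wordProd_ge (w : W) (ω : List B) :
    cs.length w ≤ cs.length (w * (cs.wordProd ω)⁻¹) + ω.length := by
  have h := cs.length_mul_le (w * (cs.wordProd ω)⁻¹) (cs.wordProd ω)
  rw [inv_mul_cancel_right] at h
  have := cs.length_wordProd_le ω
  omega

theorem length_mul_alternatingWord_le (w : W) (i j : B) {p q : ℕ} (h : p ≤ q) :
    cs.length (w * (cs.wordProd (alternatingWord i j p))⁻¹) + p ≤
      cs.length (w * (cs.wordProd (alternatingWord i j q))⁻¹) + q := by
  induction q, h using Nat.le_induction with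
  | base => exact le_rfl
  | succ q _ ih =>
    refine ih.trans ?_
    have h := cs.length_mul_simple (w * (cs.wordProd (alternatingWord i j (q + 1)))⁻¹)
      (if Even q then j else i)
    rw [wordProd_alternatingWord_succ] at h ⊢
    simp only [mul_inv_rev, inv_simple, ← mul_assoc, simple_mul_simple_cancel_right] at h ⊢
    omega

/-- If `w s_i` is longer than `w`, then the root `w α_i` is positive. -/
theorem root_nonneg_of_length_lt : ∀ (w : W) (i : B),
    cs.length w < cs.length (w * cs.simple i) → 0 ≤ cs.root w i := by
  intro w
  induction hn : cs.length w using Nat.strong_induction_on generalizing w with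
  | _ n ih =>
  subst hn
  intro i hi
  rcases eq_or_ne w 1 with rfl | hw
  · rw [root, geomRep_one_apply]
    exact Finsupp.single_nonneg.mpr zero_le_one
  obtain ⟨j, hj⟩ := cs.exists_rightDescent_of_ne_one hw
  rw [isRightDescent_iff] at hj
  have hij : i ≠ j := by
    rintro rfl
    omega
  -- `P p`: w ends in the alternating word of length p, with lengths adding. The largest such p is
  -- used.
  set P : ℕ → Prop := fun p =>
    cs.length (w * (cs.wordProd (alternatingWord i j p))⁻¹) + p = cs.length w with hP
  have hP1 : P 1 := by simpa [hP, alternatingWord] using hj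
  have hle : ∀ p, P p → p ≤ cs.length w := fun p hp => by
    change _ + p = _ at hp
    omega
  obtain ⟨p, hp1, hp, hmax⟩ : ∃ p, 1 ≤ p ∧ P p ∧ ¬ P (p + 1) := by
    by_contra! hcon
    have : ∀ p, 1 ≤ p → P p := fun p hp => by
      induction p, hp using Nat.le_induction with
      | base => exact hP1
      | succ p hp ih => exact hcon p hp ih
    have := hle _ (this (cs.length w + 1) (by omega))
    omega
  set v := w * (cs.wordProd (alternatingWord i j p))⁻¹ with hv
  change cs.length v + p = cs.length w at hp
  -- Otherwise w ends in the full braid word, which can be rewritten to end in s_i, so that w s_i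
  -- would be shorter than w.
  have hpm : M i j ≠ 0 → p + 1 ≤ M i j := by
    intro hm
    by_contra! hlt
    have h1 := cs.length_mul_alternatingWord_le w i j (p := M i j) (q := p) (by omega)
    rw [← hv] at h1
    have h2 := cs.wordProd_braidWord_eq i j
    obtain ⟨k, hk⟩ : ∃ k, M i j = k + 1 := ⟨M i j - 1, by omega⟩
    rw [braidWord, braidWord, M.symmetric j i, hk, alternatingWord_succ j i,
      wordProd_concat] at h2
    have h3 := cs.length_mul_inv_wordProd_ge (w * cs.simple i) (alternatingWord i j k)
    rw [hk, h2] at h1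
    simp only [mul_inv_rev, inv_simple, length_alternatingWord, mul_assoc] at h1 h3
    omega
  obtain ⟨a, h0, h1, ha, hnonneg⟩ :=
    CoxeterMatrix.exists_nonneg_chebyshev_seq (m := M i j) (M.off_diagonal i j hij)
  rw [cs.root_eq_add_of_chebyshev h0 h1 ha w p, ← hv]
  -- One letter lengthens v because p is maximal; the other (`hy`) because it restores the letter
  -- stripped last.
  have hx : cs.length v < cs.length (v * cs.simple (if Even p then j else i)) := by
    by_contra hcon
    apply hmax
    change cs.length (w * (cs.wordProd (alternatingWord i j (p + 1)))⁻¹) + (p + 1) = _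
    have := cs.length_mul_simple v (if Even p then j else i)
    rw [wordProd_alternatingWord_succ, mul_inv_rev, inv_simple, ← mul_assoc, ← hv]
    omega
  have hy : cs.length v < cs.length (v * cs.simple (if Even p then i else j)) := by
    obtain ⟨k, rfl⟩ : ∃ k, p = k + 1 := ⟨p - 1, by omega⟩
    have h1 := cs.length_mul_inv_wordProd_ge w (alternatingWord i j k)
    have hv' : v * cs.simple (if Even (k + 1) then i else j) =
        w * (cs.wordProd (alternatingWord i j k))⁻¹ := by
      rw [hv, wordProd_alternatingWord_succ]
      by_cases hk : Even k <;> simp [hk, Nat.even_add_one, mul_assoc]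
    rw [length_alternatingWord] at h1
    rw [hv']
    omega
  have hlt : cs.length v < cs.length w := by omega
  exact add_nonneg
    (smul_nonneg (hnonneg p fun h => by have := hpm h; omega) (ih _ hlt v rfl _ hx))
    (smul_nonneg (hnonneg (p + 1) hpm) (ih _ hlt v rfl _ hy))

/-- If `w s_i` is shorter than `w`, then the root `w α_i` is negative. -/
theorem root_nonpos_of_isRightDescent {w : W} {i : B} (h : cs.IsRightDescent w i) :
    cs.root w i ≤ 0 := by
  have h' := cs.root_nonneg_of_length_lt (w * cs.simple i) i
    (by rwa [simple_mul_simple_cancel_right])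
  rwa [root_mul_simple_self, neg_nonneg] at h'

/-- The geometric representation is faithful. -/
theorem geomRep_injective : Function.Injective cs.geomRep := by
  rw [injective_iff_map_eq_one]
  intro w hw
  by_contra hne
  obtain ⟨i, hi⟩ := cs.exists_rightDescent_of_ne_one hne
  have h := cs.root_nonpos_of_isRightDescent hi i
  rw [root, hw] at h
  simp at h
  linarith

/-- The α_i-coefficient of σ_i α_i is -1, that of σ_j α_i is 1 for j ≠ i. This makes B finite when W
is. -/
theorem simple_injective : Function.Injective cs.simple := by
  intro i j hij
  by_contra hne
  have h := DFunLike.congr_fun (congrArg cs.geomRep hij) (Finsupp.single i (1 : ℝ))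
  rw [geomRep_simple, geomRep_simple, M.geomReflection_single_self,
    M.geomReflection_single] at h
  have := DFunLike.congr_fun h i
  simp [Ne.symm hne] at this
  linarith

end CoxeterSystem

/-! ### Dominant vectors, stabilizers and the parabolic closure. -/

theorem Finsupp.linearMap_nonneg {B : Type*} {f : (B →₀ ℝ) →ₗ[ℝ] ℝ}
    (hf : ∀ b, 0 ≤ f (Finsupp.single b 1)) {x : B →₀ ℝ} (hx : 0 ≤ x) : 0 ≤ f x := by
  have h : f = Finsupp.linearCombination ℝ fun b => f (Finsupp.single b 1) := by
    ext
    simp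
  rw [h, Finsupp.linearCombination_apply]
  exact Finset.sum_nonneg fun b _ => smul_nonneg (hx b) (hf b)

namespace CoxeterSystem

variable {B W : Type*} [Group W] {M : CoxeterMatrix B} (cs : CoxeterSystem M W)

theorem mem_fixedSpace {w : W} {x : B →₀ ℝ} : x ∈ cs.fixedSpace w ↔ cs.geomRep w x = x := Iff.rfl

/-- The stabilizer of a vector of the geometric representation. -/
def vectorStabilizer (x : B →₀ ℝ) : Subgroup W where
  carrier := {w | cs.geomRep w x = x}
  mul_mem' {v w} hv hw := by
    change cs.geomRep (v * w) x = x
    rw [geomRep_mul_apply, hw, hv]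
  one_mem' := cs.geomRep_one_apply x
  inv_mem' {w} hw := by
    change cs.geomRep w⁻¹ x = x
    conv_lhs => rw [← hw]
    exact cs.geomRep_inv_apply_self w x

theorem mem_vectorStabilizer {w : W} {x : B →₀ ℝ} :
    w ∈ cs.vectorStabilizer x ↔ cs.geomRep w x = x := Iff.rfl

theorem vectorStabilizer_geomRep (w : W) (x : B →₀ ℝ) :
    cs.vectorStabilizer (cs.geomRep w x) =
      (cs.vectorStabilizer x).map (MulAut.conj w).toMonoidHom := by
  ext g
  rw [Subgroup.mem_map_equiv, mem_vectorStabilizer, mem_vectorStabilizer, MulAut.conj_symm_apply,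
    geomRep_mul_apply, geomRep_mul_apply]
  constructor
  · intro h
    rw [h, geomRep_inv_apply_self]
  · intro h
    conv_rhs => rw [← h]
    rw [geomRep_apply_inv_self]

/-- A positive definite symmetric bilinear form that is invariant under the geometric
representation. -/
structure IsInvariantInner (β : LinearMap.BilinForm ℝ (B →₀ ℝ)) : Prop where
  symm : ∀ x y, β x y = β y x
  pos : ∀ x, x ≠ 0 → 0 < β x x
  invariant : ∀ w x y, β (cs.geomRep w x) (cs.geomRep w y) = β x y

theorem exists_isInvariantInner [Finite W] [Finite B] : ∃ β, cs.IsInvariantInner β := by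
  have := Fintype.ofFinite W
  have := Fintype.ofFinite B
  set β : LinearMap.BilinForm ℝ (B →₀ ℝ) := ∑ w : W, ∑ b : B,
    LinearMap.BilinForm.linMulLin (Finsupp.lapply b ∘ₗ (cs.geomRep w).toLinearMap)
      (Finsupp.lapply b ∘ₗ (cs.geomRep w).toLinearMap) with hβ
  have happ : ∀ x y, β x y = ∑ w : W, ∑ b : B, cs.geomRep w x b * cs.geomRep w y b := by
    intro x y
    simp [hβ, LinearMap.sum_apply]
  refine ⟨β, fun x y => ?_, fun x hx => ?_, fun w x y => ?_⟩
  · simp only [happ, mul_comm]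
  · rw [happ]
    refine Finset.sum_pos' (fun w _ => Finset.sum_nonneg fun b _ => mul_self_nonneg _)
      ⟨1, Finset.mem_univ _, ?_⟩
    obtain ⟨b, hb⟩ := DFunLike.ne_iff.mp hx
    refine Finset.sum_pos' (fun b _ => mul_self_nonneg _) ⟨b, Finset.mem_univ _, ?_⟩
    rw [geomRep_one_apply]
    exact mul_self_pos.mpr hb
  · rw [happ, happ]
    simp only [← geomRep_mul_apply]
    exact Fintype.sum_equiv (Equiv.mulRight w) _ _ fun _ => rfl

namespace IsInvariantInner

variable {cs}
variable {β : LinearMap.BilinForm ℝ (B →₀ ℝ)} (hβ : cs.IsInvariantInner β)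
include hβ

theorem apply_geomRep_left (w : W) (x y : B →₀ ℝ) :
    β (cs.geomRep w x) y = β x (cs.geomRep w⁻¹ y) := by
  rw [← hβ.invariant w x, geomRep_apply_inv_self]

theorem eq_zero_of_apply_self {x : B →₀ ℝ} (h : β x x = 0) : x = 0 := by
  by_contra hx
  exact (hβ.pos x hx).ne' h

theorem isRefl : β.IsRefl := fun x y h => by rw [hβ.symm, h]

theorem nondegenerate : β.Nondegenerate :=
  (LinearMap.IsRefl.nondegenerate_iff_separatingLeft hβ.isRefl).mpr
    fun x hx => hβ.eq_zero_of_apply_self (hx x)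

theorem single_pos (i : B) : 0 < β (Finsupp.single i 1) (Finsupp.single i 1) :=
  hβ.pos _ (by simp)

/-- Invariance of β together with s_i α_i = -α_i already makes s_i the β-orthogonal reflection, so
positivity of `cosForm` is never needed. -/
theorem geomRep_simple_apply (i : B) (x : B →₀ ℝ) :
    cs.geomRep (cs.simple i) x =
      x - (2 * β x (Finsupp.single i 1) / β (Finsupp.single i 1) (Finsupp.single i 1)) •
        Finsupp.single i 1 := by
  have h1 := hβ.invariant (cs.simple i) x (Finsupp.single i 1)
  rw [geomRep_simple, M.geomReflection_single_self, M.geomReflection_apply] at h1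
  rw [geomRep_simple, M.geomReflection_apply]
  congr 2
  have := hβ.single_pos i
  simp only [map_neg, map_sub, map_smul, LinearMap.sub_apply, LinearMap.smul_apply,
    smul_eq_mul] at h1
  rw [eq_div_iff this.ne']
  linarith

theorem geomRep_simple_eq_self_iff (i : B) (x : B →₀ ℝ) :
    cs.geomRep (cs.simple i) x = x ↔ β x (Finsupp.single i 1) = 0 := by
  have h := hβ.single_pos i
  rw [hβ.geomRep_simple_apply, sub_eq_self, smul_eq_zero]
  simp [h.ne']

/-- The stabilizer of a dominant vector is generated by the simple reflections fixing it. -/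
theorem vectorStabilizer_eq_of_dominant {x : B →₀ ℝ} (hx : ∀ i, 0 ≤ β x (Finsupp.single i 1)) :
    cs.vectorStabilizer x = cs.standardParabolic {i | β x (Finsupp.single i 1) = 0} := by
  refine le_antisymm ?_ ?_
  · intro w hw
    induction hn : cs.length w using Nat.strong_induction_on generalizing w with
    | _ n ih =>
    subst hn
    rcases eq_or_ne w 1 with rfl | hne
    · exact one_mem _
    obtain ⟨i, hi⟩ := cs.exists_rightDescent_of_ne_one hne
    -- Since w fixes x, β(x, α_i) = β(x, wα_i), and wα_i is a negative root.
    have h0 : β x (Finsupp.single i 1) = 0 := by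
      refine le_antisymm ?_ (hx i)
      have h1 := hβ.invariant w x (Finsupp.single i 1)
      rw [(cs.mem_vectorStabilizer).mp hw] at h1
      have h2 := Finsupp.linearMap_nonneg hx (x := -cs.root w i)
        (neg_nonneg.mpr (cs.root_nonpos_of_isRightDescent hi))
      rw [map_neg, root, h1] at h2
      linarith
    have hs : cs.simple i ∈ cs.vectorStabilizer x :=
      (hβ.geomRep_simple_eq_self_iff i x).mpr h0
    have h := ih _ hi (mul_mem hw hs) rfl
    rw [← cs.simple_mul_simple_cancel_right (w := w) i]
    exact mul_mem h (Subgroup.subset_closure ⟨i, h0, rfl⟩)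
  · rw [standardParabolic, Subgroup.closure_le]
    rintro _ ⟨i, hi, rfl⟩
    exact (hβ.geomRep_simple_eq_self_iff i x).mpr hi

/-- Every orbit contains a dominant vector. -/
theorem exists_dominant [Finite W] (x : B →₀ ℝ) :
    ∃ w, ∀ i, 0 ≤ β (cs.geomRep w x) (Finsupp.single i 1) := by
  -- Maximize the coordinate sum over the orbit: a negative pairing with α_i would let s_i increase
  -- it.
  set f : (B →₀ ℝ) →ₗ[ℝ] ℝ := Finsupp.linearCombination ℝ fun _ => (1 : ℝ) with hf
  obtain ⟨w, hw⟩ := Finite.exists_max fun w : W => f (cs.geomRep w x)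
  refine ⟨w, fun i => ?_⟩
  by_contra! hi
  have h := hw (cs.simple i * w)
  rw [geomRep_mul_apply, hβ.geomRep_simple_apply, map_sub, map_smul] at h
  have h1 : f (Finsupp.single i 1) = 1 := by simp [hf]
  rw [h1, smul_eq_mul, mul_one] at h
  have : 2 * β (cs.geomRep w x) (Finsupp.single i 1) /
      β (Finsupp.single i 1) (Finsupp.single i 1) < 0 :=
    div_neg_of_neg_of_pos (by linarith) (hβ.single_pos i)
  linarith

/-- There is a dominant vector orthogonal to a prescribed set of simple roots. -/
theorem exists_dominant_vector [Finite B] (I : Set B) : ∃ x : B →₀ ℝ,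
    (∀ i, 0 ≤ β x (Finsupp.single i 1)) ∧ {i | β x (Finsupp.single i 1) = 0} = I := by
  classical
  set f : (B →₀ ℝ) →ₗ[ℝ] ℝ := Finsupp.linearCombination ℝ fun i => if i ∈ I then (0 : ℝ) else 1
  have h : ∀ i, β ((β.toDual hβ.nondegenerate).symm f) (Finsupp.single i 1) =
      if i ∈ I then (0 : ℝ) else 1 := fun i => by
    rw [← LinearMap.BilinForm.toDual_def hβ.nondegenerate, LinearEquiv.apply_symm_apply]
    simp [f]
  refine ⟨(β.toDual hβ.nondegenerate).symm f, fun i => ?_, Set.ext fun i => ?_⟩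
  · rw [h]
    split_ifs <;> norm_num
  · rw [Set.mem_ofPred_eq, h]
    simp

theorem isParabolic_vectorStabilizer [Finite W] (x : B →₀ ℝ) :
    cs.IsParabolic (cs.vectorStabilizer x) := by
  obtain ⟨w, hw⟩ := hβ.exists_dominant x
  refine ⟨w⁻¹, {i | β (cs.geomRep w x) (Finsupp.single i 1) = 0}, ?_⟩
  rw [← hβ.vectorStabilizer_eq_of_dominant hw, ← vectorStabilizer_geomRep,
    geomRep_inv_apply_self]

theorem exists_eq_vectorStabilizer [Finite B] {P : Subgroup W} (hP : cs.IsParabolic P) :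
    ∃ x, P = cs.vectorStabilizer x := by
  obtain ⟨w, I, rfl⟩ := hP
  obtain ⟨x, hx, rfl⟩ := hβ.exists_dominant_vector I
  exact ⟨cs.geomRep w x, by
    rw [vectorStabilizer_geomRep, hβ.vectorStabilizer_eq_of_dominant hx]⟩

end IsInvariantInner

include cs in
theorem finite_index [Finite W] : Finite B := Finite.of_injective cs.simple cs.simple_injective

/-- The parabolic closure of `u` consists of the elements fixing `V^u` pointwise. -/
theorem mem_parabolicClosure_iff [Finite W] {u v : W} :
    v ∈ cs.parabolicClosure u ↔ cs.fixedSpace u ≤ cs.fixedSpace v := by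
  have := cs.finite_index
  obtain ⟨β, hβ⟩ := cs.exists_isInvariantInner
  rw [parabolicClosure, Subgroup.mem_sInf]
  constructor
  · intro h x hx
    exact h _ ⟨hβ.isParabolic_vectorStabilizer x, hx⟩
  · rintro h P ⟨hP, hu⟩
    obtain ⟨x, rfl⟩ := hβ.exists_eq_vectorStabilizer hP
    exact h hu

/-- A nontrivial element `w` admits a reflection fixing `V^w` pointwise. -/
theorem exists_simple_conj_fixedSpace_le [Finite W] {w : W} (hw : w ≠ 1) :
    ∃ (g : W) (i : B), cs.fixedSpace w ≤ cs.fixedSpace (g * cs.simple i * g⁻¹) := by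
  have := cs.finite_index
  obtain ⟨β, hβ⟩ := cs.exists_isInvariantInner
  by_contra! hcon
  -- Each x in V^w has a nontrivial stabilizer, hence is fixed by a reflection. So finitely many
  -- subspaces cover V^w, and one of them must be all of it.
  set p : W × B → Submodule ℝ (cs.fixedSpace w) := fun t =>
    (cs.fixedSpace (t.1 * cs.simple t.2 * t.1⁻¹)).comap (cs.fixedSpace w).subtype with hp
  have hcov : ⋃ t, (p t : Set (cs.fixedSpace w)) = Set.univ := by
    refine Set.eq_univ_of_forall fun x => ?_
    obtain ⟨g, hg⟩ := hβ.exists_dominant (x : B →₀ ℝ)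
    have hstab := hβ.vectorStabilizer_eq_of_dominant hg
    have hmem : g * w * g⁻¹ ∈ cs.vectorStabilizer (cs.geomRep g x) := by
      rw [mem_vectorStabilizer, geomRep_mul_apply, geomRep_inv_apply_self, geomRep_mul_apply,
        x.2]
    obtain ⟨i, hi⟩ : {i | β (cs.geomRep g x) (Finsupp.single i 1) = 0}.Nonempty := by
      rw [Set.nonempty_iff_ne_empty]
      intro h
      rw [hstab, h, standardParabolic, Set.image_empty, Subgroup.closure_empty,
        Subgroup.mem_bot, conj_eq_one_iff] at hmem
      exact hw hmem
    have hx : (x : B →₀ ℝ) ∈ cs.fixedSpace (g⁻¹ * cs.simple i * g⁻¹⁻¹) := by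
      rw [mem_fixedSpace, geomRep_mul_apply, geomRep_mul_apply, inv_inv,
        (hβ.geomRep_simple_eq_self_iff i _).mpr hi, geomRep_inv_apply_self]
    exact Set.mem_iUnion.mpr ⟨(g⁻¹, i), hx⟩
  obtain ⟨t, ht⟩ := Subspace.exists_eq_top_of_iUnion_eq_univ (k := ℝ) (E := cs.fixedSpace w)
    (p := p) hcov
  exact hcon t.1 t.2 (Submodule.comap_subtype_eq_top.mp ht)

end CoxeterSystem

/-! ### Reflection length as codimension. -/

namespace CoxeterSystem

variable {B W : Type*} [Group W] {M : CoxeterMatrix B} (cs : CoxeterSystem M W)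

theorem fixedSpace_inf_le_mul (v w : W) :
    cs.fixedSpace v ⊓ cs.fixedSpace w ≤ cs.fixedSpace (v * w) := fun x hx => by
  rw [mem_fixedSpace, geomRep_mul_apply, cs.mem_fixedSpace.mp hx.2, cs.mem_fixedSpace.mp hx.1]

theorem fixedSpace_one : cs.fixedSpace 1 = ⊤ :=
  eq_top_iff.mpr fun x _ => cs.geomRep_one_apply x

/-- The fixed space of a reflection has codimension at most one. -/
theorem finrank_le_finrank_fixedSpace_reflection [Finite B] {t : W} (ht : cs.IsReflection t) :
    Module.finrank ℝ (B →₀ ℝ) ≤ Module.finrank ℝ (cs.fixedSpace t) + 1 := by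
  obtain ⟨g, i, rfl⟩ := ht
  set f : (B →₀ ℝ) →ₗ[ℝ] ℝ := M.cosForm (Finsupp.single i 1) ∘ₗ (cs.geomRep g⁻¹).toLinearMap
    with hf
  have hle : LinearMap.ker f ≤ cs.fixedSpace (g * cs.simple i * g⁻¹) := fun x hx => by
    have hx' : M.cosForm (Finsupp.single i 1) (cs.geomRep g⁻¹ x) = 0 := hx
    rw [mem_fixedSpace, geomRep_mul_apply, geomRep_mul_apply, geomRep_simple,
      M.geomReflection_apply, hx', mul_zero, zero_smul, sub_zero, geomRep_apply_inv_self]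
  have h1 := f.finrank_range_add_finrank_ker
  have h2 := Submodule.finrank_mono hle
  have h3 := Submodule.finrank_le (LinearMap.range f)
  rw [Module.finrank_self] at h3
  omega

/-- For `w ≠ 1` there is a reflection `t` such that `t w` has a larger fixed space than `w`. -/
theorem exists_isReflection_finrank_lt [Finite W] {w : W} (hw : w ≠ 1) :
    ∃ t, cs.IsReflection t ∧
      Module.finrank ℝ (cs.fixedSpace w) < Module.finrank ℝ (cs.fixedSpace (t * w)) := by
  have := cs.finite_index
  obtain ⟨β, hβ⟩ := cs.exists_isInvariantInner
  obtain ⟨g, i, hgi⟩ := cs.exists_simple_conj_fixedSpace_le hw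
  refine ⟨_, ⟨g, i, rfl⟩, Submodule.finrank_lt_finrank_of_lt (lt_of_le_of_ne ?_ ?_)⟩
  · exact fun x hx => cs.fixedSpace_inf_le_mul _ _ ⟨hgi hx, hx⟩
  set r := cs.root g i with hr
  -- The image of w - 1 is the orthogonal complement of V^w, so it contains r: wy = y + r for some
  -- y. As wy and y have equal norm, the reflection in r swaps them; hence tw fixes y and w does
  -- not.
  set A : (B →₀ ℝ) →ₗ[ℝ] (B →₀ ℝ) := (cs.geomRep w).toLinearMap - LinearMap.id with hA
  have hAapp : ∀ y, A y = cs.geomRep w y - y := fun y => rfl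
  have hr0 : r ≠ 0 := by
    rw [hr, root, Ne, LinearEquiv.map_eq_zero_iff]
    simp
  have horth : β.orthogonal (LinearMap.range A) ≤ cs.fixedSpace w := fun x hx => by
    rw [LinearMap.BilinForm.mem_orthogonal_iff] at hx
    have h := hx _ ⟨x, rfl⟩
    rw [hAapp, map_sub, LinearMap.sub_apply] at h
    have h2 := hβ.invariant w x x
    rw [mem_fixedSpace, ← sub_eq_zero]
    refine hβ.eq_zero_of_apply_self ?_
    simp only [map_sub, LinearMap.sub_apply, hβ.symm x (cs.geomRep w x)]
    linarith
  have hrmem : r ∈ LinearMap.range A := by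
    rw [← LinearMap.BilinForm.orthogonal_orthogonal hβ.nondegenerate hβ.isRefl
      (LinearMap.range A), LinearMap.BilinForm.mem_orthogonal_iff]
    intro x hx
    have h := hgi (horth hx)
    rw [mem_fixedSpace, geomRep_mul_apply, geomRep_mul_apply] at h
    have h2 := congrArg (cs.geomRep g⁻¹) h
    rw [geomRep_inv_apply_self, hβ.geomRep_simple_eq_self_iff] at h2
    rw [hr, root, ← hβ.invariant g⁻¹,
      geomRep_inv_apply_self, h2]
  obtain ⟨y, hy⟩ := hrmem
  have hwy : cs.geomRep w y = y + r := by rw [← hy, hAapp]; abel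
  have hyr : 2 * β (cs.geomRep w y) r = β r r := by
    have h := hβ.invariant w y y
    rw [hwy] at h ⊢
    simp only [map_add, LinearMap.add_apply, hβ.symm r y] at h ⊢
    linarith
  have hfix : y ∈ cs.fixedSpace (g * cs.simple i * g⁻¹ * w) := by
    have h1 : β (cs.geomRep g⁻¹ (cs.geomRep w y)) (Finsupp.single i 1) =
        β (cs.geomRep w y) r := by
      rw [hβ.apply_geomRep_left, inv_inv, hr, root]
    have h2 : β (Finsupp.single i 1) (Finsupp.single i 1) = β r r := by
      rw [hr, root, hβ.invariant]
    rw [mem_fixedSpace, geomRep_mul_apply, geomRep_mul_apply, geomRep_mul_apply,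
      hβ.geomRep_simple_apply, h1, h2, hyr, div_self (hβ.pos r hr0).ne', one_smul, map_sub,
      geomRep_apply_inv_self, hwy, ← root, ← hr, add_sub_cancel_right]
  intro heq
  rw [← heq, mem_fixedSpace, hwy, add_eq_left] at hfix
  exact hr0 hfix

theorem reflectionLength_le {l : List W} (hl : ∀ t ∈ l, cs.IsReflection t) :
    cs.reflectionLength l.prod ≤ l.length := Nat.sInf_le ⟨l, hl, rfl, rfl⟩

theorem reflectionLength_le_mul_add_one {t : W} (ht : cs.IsReflection t) (w : W) :
    cs.reflectionLength w ≤ cs.reflectionLength (t * w) + 1 := by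
  obtain ⟨l, hl, hprod, hlen⟩ := cs.exists_list_length_eq_reflectionLength (t * w)
  have h := cs.reflectionLength_le (l := t :: l) (List.forall_mem_cons.mpr ⟨ht, hl⟩)
  rwa [List.prod_cons, hprod, ← mul_assoc, ht.mul_self, one_mul, List.length_cons, hlen] at h

/-- Codimension of the fixed space is subadditive under products, and a reflection contributes at
most 1. -/
theorem finrank_le_finrank_fixedSpace_prod [Finite B] {l : List W}
    (hl : ∀ t ∈ l, cs.IsReflection t) :
    Module.finrank ℝ (B →₀ ℝ) ≤ Module.finrank ℝ (cs.fixedSpace l.prod) + l.length := by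
  induction l with
  | nil => rw [List.prod_nil, fixedSpace_one, finrank_top]; exact Nat.le_add_right _ _
  | cons t l ih =>
    obtain ⟨ht, hl⟩ := List.forall_mem_cons.mp hl
    have h1 := cs.finrank_le_finrank_fixedSpace_reflection ht
    have h2 := ih hl
    have h3 := Submodule.finrank_sup_add_finrank_inf_eq (cs.fixedSpace t) (cs.fixedSpace l.prod)
    have h4 := Submodule.finrank_mono (cs.fixedSpace_inf_le_mul t l.prod)
    have h5 := Submodule.finrank_le (cs.fixedSpace t ⊔ cs.fixedSpace l.prod)
    rw [List.prod_cons, List.length_cons]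
    omega

theorem reflectionLength_add_finrank_le [Finite W] (w : W) :
    cs.reflectionLength w + Module.finrank ℝ (cs.fixedSpace w) ≤ Module.finrank ℝ (B →₀ ℝ) := by
  have := cs.finite_index
  induction hn : Module.finrank ℝ (B →₀ ℝ) - Module.finrank ℝ (cs.fixedSpace w) using
    Nat.strong_induction_on generalizing w with
  | _ n ih =>
  subst hn
  rcases eq_or_ne w 1 with rfl | hw
  · have h := cs.reflectionLength_le (l := []) (by simp)
    rw [List.prod_nil, List.length_nil] at h
    have := Submodule.finrank_le (cs.fixedSpace 1)
    omega
  · obtain ⟨t, ht, hlt⟩ := cs.exists_isReflection_finrank_lt hw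
    have h1 := Submodule.finrank_le (cs.fixedSpace (t * w))
    have h2 := ih _ (by omega) (t * w) rfl
    have h3 := cs.reflectionLength_le_mul_add_one ht w
    omega

/-- Carter's lemma: the reflection length of `w` is the codimension of its fixed space. -/
theorem reflectionLength_add_finrank_fixedSpace [Finite W] (w : W) :
    cs.reflectionLength w + Module.finrank ℝ (cs.fixedSpace w) = Module.finrank ℝ (B →₀ ℝ) := by
  have := cs.finite_index
  refine le_antisymm (cs.reflectionLength_add_finrank_le w) ?_
  obtain ⟨l, hl, rfl, hlen⟩ := cs.exists_list_length_eq_reflectionLength w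
  rw [← hlen, add_comm]
  exact cs.finrank_le_finrank_fixedSpace_prod hl

/-! ### Involutions and the absolute order. -/

theorem geomRep_ext {v w : W} (h : ∀ x, cs.geomRep v x = cs.geomRep w x) : v = w :=
  cs.geomRep_injective (LinearEquiv.ext h)

theorem geomRep_involution_apply {w : W} (hw : w ^ 2 = 1) (x : B →₀ ℝ) :
    cs.geomRep w (cs.geomRep w x) = x := by
  rw [← geomRep_mul_apply, ← pow_two, hw, geomRep_one_apply]

/-- If `u` is an involution then `x + u x` is fixed by every `v` with `V^u ⊆ V^v`. -/
theorem geomRep_apply_involution {u v : W} (hu : u ^ 2 = 1)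
    (huv : cs.fixedSpace u ≤ cs.fixedSpace v) (x : B →₀ ℝ) :
    cs.geomRep v (cs.geomRep u x) = x + cs.geomRep u x - cs.geomRep v x := by
  have h : x + cs.geomRep u x ∈ cs.fixedSpace u := by
    rw [mem_fixedSpace, map_add, geomRep_involution_apply cs hu, add_comm]
  have h2 := cs.mem_fixedSpace.mp (huv h)
  rw [map_add] at h2
  rw [← h2]
  abel

/-- Involutions are β-self-adjoint, so vu = 1 + u - v is too; its adjoint is uv. -/
theorem commute_of_fixedSpace_le [Finite W] {u v : W} (hu : u ^ 2 = 1) (hv : v ^ 2 = 1)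
    (huv : cs.fixedSpace u ≤ cs.fixedSpace v) : u * v = v * u := by
  have := cs.finite_index
  obtain ⟨β, hβ⟩ := cs.exists_isInvariantInner
  have hadj : ∀ {w : W}, w ^ 2 = 1 → ∀ x y, β (cs.geomRep w x) y = β x (cs.geomRep w y) := by
    intro w hw x y
    rw [hβ.apply_geomRep_left, inv_eq_of_mul_eq_one_right (by rwa [← pow_two])]
  refine cs.geomRep_ext fun x => ?_
  rw [geomRep_mul_apply, geomRep_mul_apply, ← sub_eq_zero]
  refine hβ.nondegenerate.1 _ fun y => ?_
  rw [map_sub, LinearMap.sub_apply, cs.geomRep_apply_involution hu huv x, hadj hu, hadj hv,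
    cs.geomRep_apply_involution hu huv y]
  simp only [map_sub, map_add, LinearMap.add_apply, LinearMap.sub_apply, hadj hu, hadj hv]
  ring

theorem absLE_of_fixedSpace_le [Finite W] {u v : W} (hu : u ^ 2 = 1) (hv : v ^ 2 = 1)
    (huv : cs.fixedSpace u ≤ cs.fixedSpace v) : cs.AbsLE v u := by
  have := cs.finite_index
  have hvinv : v⁻¹ = v := inv_eq_of_mul_eq_one_right (by rwa [← pow_two])
  have hcomm := cs.commute_of_fixedSpace_le hu hv huv
  have hvu : ∀ x, cs.geomRep (v * u) x = x + cs.geomRep u x - cs.geomRep v x := fun x => by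
    rw [geomRep_mul_apply, cs.geomRep_apply_involution hu huv]
  have hinf : cs.fixedSpace v ⊓ cs.fixedSpace (v * u) = cs.fixedSpace u := by
    refine le_antisymm (fun x hx => ?_) (le_inf huv fun x hx => ?_)
    · have h := cs.mem_fixedSpace.mp hx.2
      rw [hvu, cs.mem_fixedSpace.mp hx.1, add_sub_cancel_left] at h
      exact h
    · rw [mem_fixedSpace, geomRep_mul_apply, cs.mem_fixedSpace.mp hx,
        cs.mem_fixedSpace.mp (huv hx)]
  have hsup : cs.fixedSpace v ⊔ cs.fixedSpace (v * u) = ⊤ := by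
    refine eq_top_iff.mpr fun x _ => ?_
    -- The ±1 eigenspace splitting of v: x + vx lies in V^v, and x - vx in V^{vu}.
    have hx : x = (2⁻¹ : ℝ) • (x + cs.geomRep v x) + (2⁻¹ : ℝ) • (x - cs.geomRep v x) := by
      module
    rw [hx]
    refine Submodule.add_mem_sup (Submodule.smul_mem _ _ ?_) (Submodule.smul_mem _ _ ?_)
    · rw [mem_fixedSpace, map_add, cs.geomRep_involution_apply hv, add_comm]
    · have h : cs.geomRep u (cs.geomRep v x) = x + cs.geomRep u x - cs.geomRep v x := by
        rw [← geomRep_mul_apply, hcomm, hvu]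
      rw [mem_fixedSpace, hvu, map_sub, map_sub, h, cs.geomRep_involution_apply hv]
      abel
  have h := Submodule.finrank_sup_add_finrank_inf_eq (cs.fixedSpace v) (cs.fixedSpace (v * u))
  rw [hinf, hsup, finrank_top] at h
  have h1 := cs.reflectionLength_add_finrank_fixedSpace v
  have h2 := cs.reflectionLength_add_finrank_fixedSpace (v * u)
  have h3 := cs.reflectionLength_add_finrank_fixedSpace u
  rw [AbsLE, hvinv]
  omega

/-- If `v ≤_T u`, then the fixed spaces of `v` and `v⁻¹ u` meet in `V^u` and span `V`. -/
theorem AbsLE.fixedSpace_inf_and_sup [Finite W] {u v : W} (h : cs.AbsLE v u) :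
    cs.fixedSpace v ⊓ cs.fixedSpace (v⁻¹ * u) = cs.fixedSpace u ∧
      cs.fixedSpace v ⊔ cs.fixedSpace (v⁻¹ * u) = ⊤ := by
  have := cs.finite_index
  have hle := cs.fixedSpace_inf_le_mul v (v⁻¹ * u)
  rw [mul_inv_cancel_left] at hle
  have h0 := Submodule.finrank_sup_add_finrank_inf_eq (cs.fixedSpace v)
    (cs.fixedSpace (v⁻¹ * u))
  have h1 := cs.reflectionLength_add_finrank_fixedSpace v
  have h2 := cs.reflectionLength_add_finrank_fixedSpace (v⁻¹ * u)
  have h3 := cs.reflectionLength_add_finrank_fixedSpace u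
  have h4 := Submodule.finrank_mono hle
  have h5 := Submodule.finrank_le (cs.fixedSpace v ⊔ cs.fixedSpace (v⁻¹ * u))
  rw [AbsLE] at h
  exact ⟨Submodule.eq_of_le_of_finrank_eq hle (by omega),
    Submodule.eq_top_of_finrank_eq (by omega)⟩

theorem AbsLE.fixedSpace_le [Finite W] {u v : W} (h : cs.AbsLE v u) :
    cs.fixedSpace u ≤ cs.fixedSpace v := by
  rw [← (AbsLE.fixedSpace_inf_and_sup cs h).1]
  exact inf_le_left

/-- An element below an involution in the absolute order is an involution. -/
theorem AbsLE.pow_two_eq_one [Finite W] {u v : W} (hu : u ^ 2 = 1) (h : cs.AbsLE v u) :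
    v ^ 2 = 1 := by
  refine cs.geomRep_ext fun x => ?_
  have hx : x ∈ cs.fixedSpace v ⊔ cs.fixedSpace (v⁻¹ * u) := by
    rw [(AbsLE.fixedSpace_inf_and_sup cs h).2]
    exact Submodule.mem_top
  obtain ⟨y, hy, z, hz, rfl⟩ := Submodule.mem_sup.mp hx
  have hy' := cs.mem_fixedSpace.mp hy
  -- v is the identity on V^v and agrees with u on V^{v⁻¹u}; there v²z = vuz = z + uz - vz = z.
  have hz' : cs.geomRep v z = cs.geomRep u z := by
    conv_lhs => rw [← cs.mem_fixedSpace.mp hz]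
    rw [← geomRep_mul_apply, mul_inv_cancel_left]
  have hvu := cs.geomRep_apply_involution hu (AbsLE.fixedSpace_le cs h) z
  rw [pow_two, geomRep_mul_apply, geomRep_one_apply, map_add, hy', map_add, hy', hz', hvu, hz',
    add_sub_cancel_right]

end CoxeterSystem

theorem mainTheorem5 {B W : Type*} [Group W] [Finite W] {M : CoxeterMatrix B}
    (cs : CoxeterSystem M W) (u : W) (hu : u ^ 2 = 1) (v : W) :
    List.TFAE [
      cs.AbsLE v u,
      v ^ 2 = 1 ∧ v ∈ cs.parabolicClosure u,
      v ^ 2 = 1 ∧ cs.fixedSpace u ≤ cs.fixedSpace v] ∧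
    ((cs.AbsLE v u ∨ (v ^ 2 = 1 ∧ v ∈ cs.parabolicClosure u) ∨
        (v ^ 2 = 1 ∧ cs.fixedSpace u ≤ cs.fixedSpace v)) →
      u * v = v * u) := by
  have h12 : (v ^ 2 = 1 ∧ v ∈ cs.parabolicClosure u) ↔
      (v ^ 2 = 1 ∧ cs.fixedSpace u ≤ cs.fixedSpace v) := by
    rw [cs.mem_parabolicClosure_iff]
  have h13 : cs.AbsLE v u ↔ (v ^ 2 = 1 ∧ cs.fixedSpace u ≤ cs.fixedSpace v) :=
    ⟨fun h => ⟨CoxeterSystem.AbsLE.pow_two_eq_one cs hu h,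
      CoxeterSystem.AbsLE.fixedSpace_le cs h⟩, fun h => cs.absLE_of_fixedSpace_le hu h.1 h.2⟩
  constructor
  · tfae_have 1 ↔ 3 := h13
    tfae_have 2 ↔ 3 := h12
    tfae_finish
  · rw [h12, h13, or_self, or_self]
    exact fun h => cs.commute_of_fixedSpace_le hu h.1 h.2
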